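/- Let $n\ge 2$. For a convex body $K$ (a nonempty compact convex set) in Euclidean space $\mathbb R^n$, let $R(K)$ be its circumradius, i.e. the smallest radius of a ball containing $K$, and let $V_1(K)=\frac{n}{\kappa_{n-1}}V(K,B^n[n-1])$ be its first intrinsic volume, where $B^n$ is the Euclidean unit ball, $\kappa_{m}$ is the volume of $B^m$, and the mixed volume is given by $n\,V(K,B^n[n-1])=\lim_{t\to0+}\frac1t\bigl(V(B^n+tK)-V(B^n)\bigr)$ with $V$ the volume. For a nondegenerate segment $S$, let $B_S^{n-1}$ be the closed unit ball of the $(n-1)$-dimensional linear subspace orthogonal to $S$. (i) (Linhart) Every convex body $K\subset\mathbb R^n$ satisfies $V_1(K)\ge 2R(K)$, with equality if and only if $K$ is a segment (a single point counting as a degenerate segment). (ii) There are constants $\varepsilon_0,\gamma_1,\gamma_2>0$ depending only on $n$ such that the following holds. If $K\subset\mathbb R^n$ is a convex body with more than one point and $V_1(K)\le(2+\varepsilon)R(K)$ for some $\varepsilon\in[0,\varepsilon_0]$, then there is a nondegenerate segment $S$ of length at least $(2-\gamma_1\varepsilon^2)R(K)$ such that $$S\subset K\subset S+\gamma_2R(K)\sqrt{\varepsilon}\,B_S^{n-1}.$$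 -/

import Mathlib

open Filter Topology
open scoped Pointwise

noncomputable section

/-- The Euclidean space `ℝⁿ`. Convex bodies (nonempty compact convex sets) in it are
Mathlib's `ConvexBody (RSpace n)`. -/
abbrev RSpace (n : ℕ) : Type := EuclideanSpace ℝ (Fin n)

/-- The closed Euclidean unit ball `Bⁿ`. -/
def unitBall (n : ℕ) : Set (RSpace n) := Metric.closedBall 0 1

/-- The volume (Lebesgue measure) of a subset of `ℝⁿ`, as a real number. -/
def vol {n : ℕ} (A : Set (RSpace n)) : ℝ := (MeasureTheory.volume A).toReal

/-- `κ_m`, the volume of the unit ball of `ℝᵐ`. -/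
def kappa (m : ℕ) : ℝ := vol (unitBall m)

/-- The mixed volume `V(K, M[n-1])`, with one copy of `K` and `n - 1` copies of `M`, determined by
`n V(K, M[n-1]) = lim_{t → 0+} (V(M + t K) - V(M)) / t`.
The limit exists whenever `K` and `M` are nonempty, compact and convex. -/
def mixedVolumeOne {n : ℕ} (K M : Set (RSpace n)) : ℝ :=
  (1 / (n : ℝ)) * limUnder (𝓝[>] (0 : ℝ)) (fun t : ℝ => (vol (M + t • K) - vol M) / t)

/-- The first intrinsic volume `V₁(K) = (n / κ_{n-1}) V(K, Bⁿ[n-1])`. -/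
def firstIntrinsicVolume {n : ℕ} (K : ConvexBody (RSpace n)) : ℝ :=
  ((n : ℝ) / kappa (n - 1)) * mixedVolumeOne (K : Set (RSpace n)) (unitBall n)

/-- The circumradius `R(K)`: the smallest radius of a closed ball containing `K`. -/
def circumradius {n : ℕ} (K : ConvexBody (RSpace n)) : ℝ :=
  sInf {r : ℝ | 0 ≤ r ∧ ∃ c : RSpace n, (K : Set (RSpace n)) ⊆ Metric.closedBall c r}

/-- For the segment `S = [x, y]` with `x ≠ y`, the set `B_S^{n-1}`: the closed unit ball of the
`(n-1)`-dimensional linear subspace orthogonal to `S`. -/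
def orthBall {n : ℕ} (x y : RSpace n) : Set (RSpace n) :=
  {v : RSpace n | ‖v‖ ≤ 1 ∧ inner ℝ v (y - x) = 0}

end

/-! Write h for the support function of K. The radial function of `B + tK` is `1 + t h(u)` up to
`O(t²)`, so in polar coordinates the volume of `B + tK` has derivative `∫ h` over the sphere at `t =
0`. Symmetrizing in u turns `V₁` into the integral of the width of K divided by `2κ_{n-1}`. The
sphere integral of `|⟪v, u⟫|` is `2κ_{n-1}‖v‖`, and the width of a triangle is half the sum of its
projected sides, so `V₁(K)` is at least half the perimeter of every triangle in K
(`dist_add_dist_add_dist_le_firstIntrinsicVolume`).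

The rest is plane geometry. Let a, b be a farthest pair among the points of K on the circumsphere,
with centre c, and let `s = ‖(a - c) + (b - c)‖` measure how far they are from antipodal. A third
contact point q on the other side of c makes the triangle abq have half-perimeter at least `2R +
s/20` (`exists_nearly_antipodal_contact_points`). This gives `V₁ ≥ 2R`, and if `V₁ ≤ (2 + ε)R` then
`s = O(εR)`, so K has diameter at least `(2 - O(ε²))R`.

For a diameter `[x, y]` and any z in K, the triangle xyz bounds the detour through z by `O(εR)`; by
Pythagoras z lies within `O(R√ε)` of the segment (`exists_segment_add_orthogonal`). The equality
case is `ε = 0`. -/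

/-! ### Support functions and the radial function of `B + tK`. -/

section SupportFunction

variable {E : Type*} [NormedAddCommGroup E] [InnerProductSpace ℝ E]

/-- The support function `u ↦ max_{x ∈ K} ⟪x, u⟫` of a set `K`. -/
noncomputable def supportFun (K : Set E) (u : E) : ℝ :=
  sSup ((fun x : E => inner ℝ x u) '' K)

theorem exists_inner_eq_supportFun {K : Set E} (hK : IsCompact K) (hne : K.Nonempty) (u : E) :
    ∃ p ∈ K, supportFun K u = inner ℝ p u := by
  obtain ⟨p, hp, h⟩ := hK.exists_sSup_image_eq hne
    (f := fun x : E => inner ℝ x u) (by fun_prop)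
  exact ⟨p, hp, h⟩

theorem inner_le_supportFun {K : Set E} (hK : IsCompact K) {x : E} (hx : x ∈ K) (u : E) :
    inner ℝ x u ≤ supportFun K u :=
  le_csSup (hK.image (by fun_prop : Continuous fun x : E => inner ℝ x u)).bddAbove ⟨x, hx, rfl⟩

theorem supportFun_smul_of_pos {K : Set E} (hK : IsCompact K) (hne : K.Nonempty) {r : ℝ}
    (hr : 0 < r) (u : E) : supportFun K (r • u) = r * supportFun K u := by
  obtain ⟨p, hp, h⟩ := exists_inner_eq_supportFun hK hne u
  obtain ⟨q, hq, h'⟩ := exists_inner_eq_supportFun hK hne (r • u)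
  apply le_antisymm
  · rw [h', real_inner_smul_right]
    exact mul_le_mul_of_nonneg_left (inner_le_supportFun hK hq u) hr.le
  · rw [h, ← real_inner_smul_right]
    exact inner_le_supportFun hK hp _

theorem supportFun_le_add {K : Set E} (hK : IsCompact K) (hne : K.Nonempty) {C : ℝ}
    (hC : ∀ x ∈ K, ‖x‖ ≤ C) (u v : E) : supportFun K u ≤ supportFun K v + C * dist u v := by
  obtain ⟨p, hp, h⟩ := exists_inner_eq_supportFun hK hne u
  have h1 := inner_le_supportFun hK hp v
  have h2 : inner ℝ p u = inner ℝ p v + inner ℝ p (u - v) := by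
    rw [← inner_add_right]; congr 1; abel
  have h3 := real_inner_le_norm p (u - v)
  have h4 := mul_le_mul_of_nonneg_right (hC p hp) (norm_nonneg (u - v))
  rw [dist_eq_norm]
  linarith

theorem continuous_supportFun {K : Set E} (hK : IsCompact K) (hne : K.Nonempty) :
    Continuous (supportFun K) := by
  obtain ⟨C, hC⟩ := hK.isBounded.exists_norm_le
  have hC0 : 0 ≤ C := (norm_nonneg _).trans (hC _ hne.some_mem)
  exact (LipschitzWith.of_le_add_mul ⟨C, hC0⟩ fun u v => supportFun_le_add hK hne hC u v).continuous

theorem abs_supportFun_le {K : Set E} (hK : IsCompact K) (hne : K.Nonempty) {C : ℝ}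
    (hC : ∀ x ∈ K, ‖x‖ ≤ C) {u : E} (hu : ‖u‖ = 1) : |supportFun K u| ≤ C := by
  obtain ⟨p, hp, h⟩ := exists_inner_eq_supportFun hK hne u
  rw [h]
  have := abs_real_inner_le_norm p u
  rw [hu, mul_one] at this
  exact this.trans (hC p hp)

theorem norm_le_of_mem_closedBall_add_smul {K : Set E} (hK : IsCompact K) {t : ℝ} (ht : 0 ≤ t)
    {x u : E} {r : ℝ} (hu : ‖u‖ = 1) (hxu : x = r • u)
    (hx : x ∈ Metric.closedBall (0 : E) 1 + t • K) : r ≤ 1 + t * supportFun K u := by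
  obtain ⟨b, hb, _, ⟨k, hk, rfl⟩, rfl⟩ := hx
  have h1 : inner ℝ (b + t • k) u = r := by
    change b + t • k = _ at hxu
    rw [hxu, real_inner_smul_left, real_inner_self_eq_norm_sq, hu]; ring
  rw [inner_add_left, real_inner_smul_left] at h1
  have h2 := real_inner_le_norm b u
  have h3 : ‖b‖ ≤ 1 := by simpa using hb
  have h4 := mul_le_mul_of_nonneg_left (inner_le_supportFun hK hk u) ht
  rw [hu] at h2
  linarith

/-- Subtracting `t • p`, with p a support point in direction u, should bring `r • u` into the unit
ball. The part of `t • p` orthogonal to u costs only second order in t, which the term `(t * C) ^ 2`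
absorbs. -/
theorem smul_mem_closedBall_add_smul {K : Set E} (hK : IsCompact K) (hne : K.Nonempty) {C : ℝ}
    (hC : ∀ x ∈ K, ‖x‖ ≤ C) {t : ℝ} (ht : 0 ≤ t) (htC : t * C ≤ 1)
    {u : E} (hu : ‖u‖ = 1) {r : ℝ} (hr : 0 ≤ r) (hr' : r ≤ 1 + t * supportFun K u - (t * C) ^ 2) :
    r • u ∈ Metric.closedBall (0 : E) 1 + t • K := by
  obtain ⟨p, hp, h⟩ := exists_inner_eq_supportFun hK hne u
  refine ⟨r • u - t • p, ?_, t • p, ⟨p, hp, rfl⟩, by simp⟩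
  rw [mem_closedBall_zero_iff]
  have key : ‖r • u - t • p‖ ^ 2 = r ^ 2 - 2 * r * (t * inner ℝ p u) + (t * ‖p‖) ^ 2 := by
    rw [norm_sub_sq_real, norm_smul, norm_smul, hu, real_inner_smul_left, real_inner_smul_right,
      real_inner_comm]
    simp only [Real.norm_eq_abs, mul_pow, sq_abs]
    ring
  have hpC : t * ‖p‖ ≤ t * C := mul_le_mul_of_nonneg_left (hC p hp) ht
  have hp0 : 0 ≤ t * ‖p‖ := by positivity
  have hsq : (t * ‖p‖) ^ 2 ≤ (t * C) ^ 2 := pow_le_pow_left₀ hp0 hpC 2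
  have hsq1 : (t * C) ^ 2 ≤ 1 := pow_le_one₀ (hp0.trans hpC) htC
  rw [h] at hr'
  set y := (t * C) ^ 2 with hy
  set a := t * inner ℝ p u with ha
  have hy0 : 0 ≤ y := sq_nonneg _
  have : ‖r • u - t • p‖ ^ 2 ≤ 1 := by
    rw [key]
    -- If `r ≤ a`, then `r² - 2ra ≤ 0` and only `y ≤ 1` remains. Otherwise `0 ≤ r - a ≤ 1 - y`, and
    -- completing the square leaves `(1 - y)² + y ≤ 1`.
    rcases le_total r a with hra | hra
    · nlinarith
    · have : (r - a) ^ 2 ≤ (1 - y) ^ 2 := pow_le_pow_left₀ (by linarith) (by linarith) 2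
      nlinarith [sq_nonneg a]
  exact (sq_le_one_iff₀ (norm_nonneg _)).1 this

end SupportFunction

/-! ### Circumcentre and contact points. -/

section Circumradius

variable {n : ℕ}

theorem bddBelow_circumradius (K : ConvexBody (RSpace n)) :
    BddBelow {r : ℝ | 0 ≤ r ∧ ∃ c : RSpace n, (K : Set (RSpace n)) ⊆ Metric.closedBall c r} :=
  ⟨0, fun _ h => h.1⟩

theorem circumradius_le (K : ConvexBody (RSpace n)) {r : ℝ} (hr : 0 ≤ r) {c : RSpace n}
    (h : (K : Set (RSpace n)) ⊆ Metric.closedBall c r) : circumradius K ≤ r :=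
  csInf_le (bddBelow_circumradius K) ⟨hr, c, h⟩

theorem circumradius_nonneg (K : ConvexBody (RSpace n)) : 0 ≤ circumradius K :=
  Real.sInf_nonneg fun _ h => h.1

/-- The infimum is attained: centres of balls of radius `R + 1/(k+1)` stay bounded, and a limit of a
subsequence serves as centre. -/
theorem exists_circumcenter (K : ConvexBody (RSpace n)) :
    ∃ c : RSpace n, (K : Set (RSpace n)) ⊆ Metric.closedBall c (circumradius K) := by
  set R := circumradius K with hR
  have hne : {r : ℝ | 0 ≤ r ∧ ∃ c : RSpace n,
      (K : Set (RSpace n)) ⊆ Metric.closedBall c r}.Nonempty := by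
    obtain ⟨r, hr⟩ := K.isCompact.isBounded.subset_closedBall (0 : RSpace n)
    exact ⟨max r 0, le_max_right _ _, 0,
      hr.trans (Metric.closedBall_subset_closedBall (le_max_left _ _))⟩
  have step : ∀ k : ℕ, ∃ c : RSpace n,
      (K : Set (RSpace n)) ⊆ Metric.closedBall c (R + 1 / ((k : ℝ) + 1)) := by
    intro k
    obtain ⟨r, ⟨-, c, hc⟩, hr⟩ := exists_lt_of_csInf_lt hne
      (show circumradius K < R + 1 / ((k : ℝ) + 1) by
        rw [← hR]; linarith [Nat.one_div_pos_of_nat (α := ℝ) (n := k)])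
    exact ⟨c, hc.trans (Metric.closedBall_subset_closedBall hr.le)⟩
  choose c hc using step
  obtain ⟨x₀, hx₀⟩ := K.nonempty
  have hbd : ∀ k, c k ∈ Metric.closedBall x₀ (R + 1) := by
    intro k
    have h1 := hc k hx₀
    rw [Metric.mem_closedBall, dist_comm] at h1
    rw [Metric.mem_closedBall]
    have : 1 / ((k : ℝ) + 1) ≤ 1 := by
      rw [div_le_one (by positivity)]; linarith [Nat.cast_nonneg (α := ℝ) k]
    linarith
  obtain ⟨a, -, φ, hφ, hlim⟩ := (isCompact_closedBall x₀ (R + 1)).tendsto_subseq hbd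
  refine ⟨a, fun x hx => ?_⟩
  have h1 : Tendsto (fun k => dist x (c (φ k))) atTop (𝓝 (dist x a)) := tendsto_const_nhds.dist hlim
  have h2 : Tendsto (fun k => R + 1 / ((φ k : ℝ) + 1)) atTop (𝓝 (R + 0)) :=
    tendsto_const_nhds.add (tendsto_one_div_add_atTop_nhds_zero_nat.comp hφ.tendsto_atTop)
  rw [add_zero] at h2
  exact le_of_tendsto_of_tendsto' h1 h2 fun k => hc (φ k) hx

/-- The points of `K` on the boundary of the circumball are not contained in an open half-space
through the circumcentre. -/
theorem exists_contact_point (K : ConvexBody (RSpace n)) {c : RSpace n}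
    (hc : (K : Set (RSpace n)) ⊆ Metric.closedBall c (circumradius K)) (v : RSpace n) :
    ∃ x ∈ K, dist x c = circumradius K ∧ inner ℝ (x - c) v ≤ 0 := by
  set R := circumradius K with hR
  have far : ∀ d : RSpace n, ∃ x ∈ K, R ≤ dist x d := by
    intro d
    obtain ⟨x, hx, hmax⟩ := K.isCompact.exists_isMaxOn K.nonempty
      (f := fun x => dist x d) (by fun_prop)
    exact ⟨x, hx, circumradius_le K dist_nonneg fun y hy => hmax hy⟩
  -- Move the centre slightly in direction v. Some point of K is still at distance at least R from
  -- the new centre; a limit of such points is the required contact point.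
  choose x hxK hx using fun k : ℕ => far (c + (1 / ((k : ℝ) + 1)) • v)
  obtain ⟨a, haK, φ, hφ, hlim⟩ := K.isCompact.tendsto_subseq hxK
  have hs : Tendsto (fun k => 1 / ((φ k : ℝ) + 1)) atTop (𝓝 0) :=
    tendsto_one_div_add_atTop_nhds_zero_nat.comp hφ.tendsto_atTop
  refine ⟨a, haK, le_antisymm (hc haK) ?_, ?_⟩
  · have h1 : Tendsto (fun k => dist (x (φ k)) (c + (1 / ((φ k : ℝ) + 1)) • v)) atTop
        (𝓝 (dist a (c + (0 : ℝ) • v))) :=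
      hlim.dist (tendsto_const_nhds.add (hs.smul_const v))
    rw [zero_smul, add_zero] at h1
    exact ge_of_tendsto' h1 fun k => hx (φ k)
  · have h1 : Tendsto (fun k => 2 * inner ℝ (x (φ k) - c) v) atTop (𝓝 (2 * inner ℝ (a - c) v)) :=
      ((hlim.sub_const c).inner tendsto_const_nhds).const_mul 2
    have h2 : Tendsto (fun k => 1 / ((φ k : ℝ) + 1) * ‖v‖ ^ 2) atTop (𝓝 (0 * ‖v‖ ^ 2)) :=
      hs.mul_const _
    -- Expand `‖x - c - s v‖² ≥ R² ≥ ‖x - c‖²` and divide by s.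
    have h3 : ∀ k, 2 * inner ℝ (x (φ k) - c) v ≤ 1 / ((φ k : ℝ) + 1) * ‖v‖ ^ 2 := by
      intro k
      set s := 1 / ((φ k : ℝ) + 1) with hs'
      have hs0 : 0 < s := Nat.one_div_pos_of_nat
      have e1 : R ≤ ‖(x (φ k) - c) - s • v‖ := by
        have := hx (φ k)
        rwa [dist_eq_norm, ← sub_sub] at this
      have e2 : ‖x (φ k) - c‖ ≤ R := by
        have := hc (hxK (φ k))
        rwa [Metric.mem_closedBall, dist_eq_norm] at this
      have e3 : R ^ 2 ≤ ‖(x (φ k) - c) - s • v‖ ^ 2 :=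
        pow_le_pow_left₀ (circumradius_nonneg K) e1 2
      have e4 := pow_le_pow_left₀ (norm_nonneg _) e2 2
      rw [norm_sub_sq_real, real_inner_smul_right, norm_smul, Real.norm_eq_abs,
        abs_of_pos hs0] at e3
      have : s * (2 * inner ℝ (x (φ k) - c) v) ≤ s * (s * ‖v‖ ^ 2) := by nlinarith
      exact le_of_mul_le_mul_left this hs0
    have := le_of_tendsto_of_tendsto' h1 h2 h3
    linarith

end Circumradius

/-! ### Polar coordinates. -/

section Polar
open MeasureTheory

variable {E : Type*} [NormedAddCommGroup E] [NormedSpace ℝ E]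

/-- The open star-shaped region about the origin (with the origin removed) with radial function
`g`. -/
def radialRegion (g : Metric.sphere (0 : E) 1 → ℝ) : Set E :=
  {x | ∃ (u : Metric.sphere (0 : E) 1) (r : ℝ), 0 < r ∧ r < g u ∧ x = r • (u : E)}

variable [FiniteDimensional ℝ E] [MeasurableSpace E] [BorelSpace E] [Nontrivial E]

/-- Along each ray the mass is `∫ r^(d-1) dr` from 0 to `g u`. -/
theorem measure_radialRegion (μ : Measure E) [μ.IsAddHaarMeasure]
    {g : Metric.sphere (0 : E) 1 → ℝ} (hg : Continuous g) (hpos : ∀ u, 0 < g u) :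
    μ (radialRegion g) = ∫⁻ u, ENNReal.ofReal (g u ^ Module.finrank ℝ E / Module.finrank ℝ E)
      ∂μ.toSphere := by
  set T : Set (Metric.sphere (0 : E) 1 × Set.Ioi (0 : ℝ)) := {z | (z.2 : ℝ) < g z.1} with hT
  have hTm : MeasurableSet T :=
    (isOpen_lt (by fun_prop) (by fun_prop)).measurableSet
  have himg : radialRegion g =
      Subtype.val '' ((homeomorphUnitSphereProd E) ⁻¹' T) := by
    rw [← Homeomorph.image_symm, Set.image_image]
    ext x
    constructor
    · rintro ⟨u, r, hr, hru, rfl⟩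
      exact ⟨(u, ⟨r, hr⟩), hru, by simp⟩
    · rintro ⟨⟨u, r⟩, hz, rfl⟩
      exact ⟨u, r, r.2, hz, by simp⟩
  have hfr : Module.finrank ℝ E - 1 + 1 = Module.finrank ℝ E :=
    Nat.sub_add_cancel Module.finrank_pos
  rw [himg, ← (MeasurableEmbedding.subtype_coe (measurableSet_singleton _).compl).comap_apply,
    μ.measurePreserving_homeomorphUnitSphereProd.measure_preimage hTm.nullMeasurableSet,
    Measure.prod_apply hTm]
  refine lintegral_congr fun u => ?_
  have : Prod.mk u ⁻¹' T = Set.Iio (⟨g u, hpos u⟩ : Set.Ioi (0 : ℝ)) := by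
    ext r; simp [hT, ← Subtype.coe_lt_coe]
  rw [this, Measure.volumeIoiPow_apply_Iio, hfr]
  congr 2
  exact_mod_cast congrArg (Nat.cast : ℕ → ℝ) hfr

theorem measureReal_radialRegion (μ : Measure E) [μ.IsAddHaarMeasure]
    {g : Metric.sphere (0 : E) 1 → ℝ} (hg : Continuous g) (hpos : ∀ u, 0 < g u) :
    μ.real (radialRegion g) =
      ∫ u, g u ^ Module.finrank ℝ E / Module.finrank ℝ E ∂μ.toSphere := by
  rw [measureReal_def, measure_radialRegion μ hg hpos, integral_eq_lintegral_of_nonneg_ae]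
  · exact Eventually.of_forall fun u => by have := (hpos u).le; positivity
  · exact (by fun_prop : Continuous fun u =>
      g u ^ Module.finrank ℝ E / (Module.finrank ℝ E : ℝ)).aestronglyMeasurable

theorem measureReal_closedBall_one_eq_integral (μ : Measure E) [μ.IsAddHaarMeasure] :
    μ.real (Metric.closedBall (0 : E) 1) = ∫ _, 1 / (Module.finrank ℝ E : ℝ) ∂μ.toSphere := by
  have h : (Module.finrank ℝ E : ℝ) ≠ 0 := by exact_mod_cast Module.finrank_pos.ne'
  rw [integral_const, μ.toSphere_real_apply_univ, measureReal_def, measureReal_def,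
    μ.addHaar_closedBall_eq_addHaar_ball, smul_eq_mul]
  field_simp

/-- Integration in polar coordinates of a positively homogeneous function of degree one against a
radial weight. -/
theorem integral_homogeneous_mul_radial (μ : Measure E) [μ.IsAddHaarMeasure]
    {f : E → ℝ} (hf : ∀ (r : ℝ) (x : E), 0 < r → f (r • x) = r * f x) (w : ℝ → ℝ) :
    ∫ x, f x * w ‖x‖ ∂μ = (∫ u : Metric.sphere (0 : E) 1, f u ∂μ.toSphere) *
      ∫ r in Set.Ioi (0 : ℝ), r ^ Module.finrank ℝ E * w r := by
  have hfr : Module.finrank ℝ E - 1 + 1 = Module.finrank ℝ E :=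
    Nat.sub_add_cancel Module.finrank_pos
  calc
    ∫ x, f x * w ‖x‖ ∂μ = ∫ x : ({(0)}ᶜ : Set E), f x * w ‖x.1‖ ∂(μ.comap (↑)) := by
      rw [integral_subtype_comap (measurableSet_singleton _).compl fun x ↦ f x * w ‖x‖,
        restrict_compl_singleton]
    _ = ∫ z, f (z.1 : E) * ((z.2 : ℝ) * w z.2)
          ∂μ.toSphere.prod (.volumeIoiPow (Module.finrank ℝ E - 1)) := by
      rw [← μ.measurePreserving_homeomorphUnitSphereProd.integral_comp
        (Homeomorph.measurableEmbedding _)]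
      refine integral_congr_ae (Eventually.of_forall fun x => ?_)
      have hx : (x : E) ≠ 0 := x.2
      have hx' : 0 < ‖(x : E)‖ := norm_pos_iff.2 hx
      simp only [homeomorphUnitSphereProd_apply_snd_coe, homeomorphUnitSphereProd_apply_fst_coe]
      rw [hf _ _ (inv_pos.2 hx')]
      field_simp
    _ = (∫ u : Metric.sphere (0 : E) 1, f u ∂μ.toSphere) *
          ∫ r : Set.Ioi (0 : ℝ), (r : ℝ) * w r ∂.volumeIoiPow (Module.finrank ℝ E - 1) :=
      integral_prod_mul (fun u : Metric.sphere (0 : E) 1 => f u)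
        (fun r : Set.Ioi (0 : ℝ) => (r : ℝ) * w r)
    _ = _ := by
      congr 1
      simp only [Measure.volumeIoiPow, ENNReal.ofReal]
      rw [integral_withDensity_eq_integral_smul,
        integral_subtype_comap measurableSet_Ioi
          fun a ↦ Real.toNNReal (a ^ (Module.finrank ℝ E - 1)) • (a * w a),
        setIntegral_congr_fun measurableSet_Ioi fun x hx ↦ ?_]
      · rw [NNReal.smul_def, Real.coe_toNNReal _ (pow_nonneg hx.out.le _), smul_eq_mul]
        rw [← mul_assoc, ← pow_succ, hfr]
      · exact (measurable_subtype_coe.pow_const _).real_toNNReal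

end Polar

/-! ### First variation of the volume of `B + tK`. -/

section ParallelBody
open MeasureTheory

theorem one_add_pow_le_quadratic {y : ℝ} (hy : |y| ≤ 1) (k : ℕ) :
    (1 + y) ^ k ≤ 1 + k * y + 4 ^ k * y ^ 2 := by
  obtain ⟨h1, h2⟩ := abs_le.1 hy
  induction k with
  | zero => simp; positivity
  | succ k ih =>
    have h3 : (k : ℝ) ≤ 4 ^ k := by exact_mod_cast (Nat.lt_pow_self (by norm_num : 1 < 4)).le
    have h4 : (0 : ℝ) ≤ 4 ^ k := by positivity
    have h5 := mul_le_mul_of_nonneg_right ih (by linarith : 0 ≤ 1 + y)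
    rw [pow_succ, pow_succ]
    push_cast
    have h6 : 4 ^ k * (y * y ^ 2) ≤ 4 ^ k * (1 * y ^ 2) := by gcongr
    have h7 : k * y ^ 2 ≤ 4 ^ k * y ^ 2 := by gcongr
    nlinarith [mul_nonneg h4 (sq_nonneg y)]

variable {E : Type*} [NormedAddCommGroup E] [InnerProductSpace ℝ E]
  [FiniteDimensional ℝ E] [MeasurableSpace E] [BorelSpace E]

theorem integrable_toSphere_of_continuous (μ : Measure E) [μ.IsAddHaarMeasure]
    {g : Metric.sphere (0 : E) 1 → ℝ} (hg : Continuous g) : Integrable g μ.toSphere :=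
  hg.integrable_of_hasCompactSupport (HasCompactSupport.of_compactSpace _)

variable [Nontrivial E]

/-- The lower and upper first-order estimates for the volume of the parallel body `B + t K`. -/
theorem measureReal_closedBall_add_smul_bounds (μ : Measure E) [μ.IsAddHaarMeasure] {K : Set E}
    (hK : IsCompact K) (hne : K.Nonempty) {C : ℝ} (hC1 : 1 ≤ C) (hC : ∀ x ∈ K, ‖x‖ ≤ C)
    {t : ℝ} (ht : 0 < t) (htC : t * C ≤ 1 / 4) :
    -(t ^ 2 * (C ^ 2 * μ.toSphere.real Set.univ)) ≤
        μ.real (Metric.closedBall (0 : E) 1 + t • K) - μ.real (Metric.closedBall (0 : E) 1) -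
          t * ∫ u : Metric.sphere (0 : E) 1, supportFun K u ∂μ.toSphere ∧
      μ.real (Metric.closedBall (0 : E) 1 + t • K) - μ.real (Metric.closedBall (0 : E) 1) -
          t * ∫ u : Metric.sphere (0 : E) 1, supportFun K u ∂μ.toSphere ≤
        t ^ 2 * ((1 + 4 ^ Module.finrank ℝ E * (4 * C ^ 2)) * μ.toSphere.real Set.univ) := by
  set d := Module.finrank ℝ E with hd
  have hd1 : (1 : ℝ) ≤ d := by exact_mod_cast (Module.finrank_pos : 0 < Module.finrank ℝ E)
  set h : Metric.sphere (0 : E) 1 → ℝ := fun u => supportFun K u with hh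
  have hcont : Continuous h := (continuous_supportFun hK hne).comp continuous_subtype_val
  have habs : ∀ u, |h u| ≤ C := fun u => abs_supportFun_le hK hne hC (by simp)
  have hth : ∀ u, |t * h u| ≤ t * C := fun u => by
    rw [abs_mul, abs_of_pos ht]; exact mul_le_mul_of_nonneg_left (habs u) ht.le
  have htle : t ≤ t * C := le_mul_of_one_le_right ht.le hC1
  have hsq : (t * C) ^ 2 ≤ 1 / 4 := by nlinarith
  have htsq : t ^ 2 ≤ t * C := by nlinarith
  have hint : Integrable h μ.toSphere := integrable_toSphere_of_continuous μ hcont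
  have hcomp : IsCompact (Metric.closedBall (0 : E) 1 + t • K) :=
    (isCompact_closedBall 0 1).add (hK.smul t)
  have hball := measureReal_closedBall_one_eq_integral μ
  rw [← hd] at hball
  have hconst : ∀ a : ℝ, ∫ _, a ∂μ.toSphere = a * μ.toSphere.real Set.univ := fun a => by
    rw [integral_const, smul_eq_mul, mul_comm]
  have expand : ∀ a b : ℝ, ∫ u, (1 / (d : ℝ) + a * h u + b) ∂μ.toSphere =
      μ.real (Metric.closedBall (0 : E) 1) + a * ∫ u, h u ∂μ.toSphere +
        b * μ.toSphere.real Set.univ := by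
    intro a b
    have i1 : Integrable (fun u => 1 / (d : ℝ) + a * h u) μ.toSphere :=
      (integrable_const _).add (hint.const_mul a)
    rw [integral_add i1 (integrable_const _),
      integral_add (integrable_const _) (hint.const_mul a), integral_const_mul, hconst, hball,
      hconst, hconst]
  constructor
  -- Lower bound: an inscribed star-shaped region, followed by Bernoulli's inequality.
  · have hpos : ∀ u, 0 < 1 + t * h u - (t * C) ^ 2 := fun u => by
      have := (abs_le.1 (hth u)).1; linarith
    have hsub : radialRegion (fun u => 1 + t * h u - (t * C) ^ 2) ⊆
        Metric.closedBall (0 : E) 1 + t • K := by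
      rintro _ ⟨u, r, hr, hru, rfl⟩
      exact smul_mem_closedBall_add_smul hK hne hC ht.le (by linarith) (by simp) hr.le hru.le
    have h1 := measureReal_mono hsub hcomp.measure_lt_top.ne (μ := μ)
    rw [measureReal_radialRegion μ (by fun_prop) hpos, ← hd] at h1
    have h2 := integral_mono (μ := μ.toSphere)
      (f := fun u => 1 / (d : ℝ) + t * h u + -(t * C) ^ 2)
      (g := fun u => (1 + t * h u - (t * C) ^ 2) ^ d / d)
      (integrable_toSphere_of_continuous μ (by fun_prop))
      (integrable_toSphere_of_continuous μ (by fun_prop)) (fun u => by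
        have h3 := one_add_mul_le_pow (a := t * h u - (t * C) ^ 2)
          (by have := hpos u; linarith) d
        rw [← add_sub_assoc] at h3
        simp only
        rw [le_div_iff₀ (by linarith)]
        refine le_trans (le_of_eq ?_) h3
        field_simp
        ring)
    rw [expand] at h2
    simp only [hh] at h1 h2 ⊢
    linarith
  -- Upper bound: the extra `t ^ 2` turns `r ≤ 1 + t h` into the strict inequality `radialRegion`
  -- asks for, and the origin, which that region omits, is added back as a null set.
  · have hpos : ∀ u, 0 < 1 + t * h u + t ^ 2 := fun u => by
      have := (abs_le.1 (hth u)).1; nlinarith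
    have hsub : Metric.closedBall (0 : E) 1 + t • K ⊆
        insert 0 (radialRegion (fun u => 1 + t * h u + t ^ 2)) := by
      intro x hx
      rcases eq_or_ne x 0 with rfl | hx0
      · exact Set.mem_insert _ _
      · right
        have hx' : 0 < ‖x‖ := norm_pos_iff.2 hx0
        have hu : ‖‖x‖⁻¹ • x‖ = 1 := by rw [norm_smul, norm_inv, norm_norm]; field_simp
        have hxu : x = ‖x‖ • (‖x‖⁻¹ • x) := by rw [smul_smul, mul_inv_cancel₀ hx'.ne', one_smul]
        refine ⟨⟨‖x‖⁻¹ • x, by simpa using hu⟩, ‖x‖, hx', ?_, hxu⟩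
        have := norm_le_of_mem_closedBall_add_smul hK ht.le hu hxu hx
        simp only [hh]
        nlinarith
    have hfin : μ (insert 0 (radialRegion (fun u => 1 + t * h u + t ^ 2))) ≠ ⊤ := by
      refine ne_top_of_le_ne_top ?_ (measure_mono (t := Metric.closedBall (0 : E) 2) ?_)
      · exact (isCompact_closedBall _ _).measure_lt_top.ne
      · rintro x (rfl | ⟨u, r, hr, hru, rfl⟩)
        · simp
        · rw [mem_closedBall_zero_iff, norm_smul, Real.norm_eq_abs, abs_of_pos hr]
          have := (abs_le.1 (hth u)).2
          simp only [norm_eq_of_mem_sphere, mul_one]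
          linarith
    have h1 := measureReal_mono hsub hfin (μ := μ)
    have h1' : μ.real (insert 0 (radialRegion (fun u => 1 + t * h u + t ^ 2))) =
        μ.real (radialRegion (fun u => 1 + t * h u + t ^ 2)) :=
      measureReal_congr (insert_ae_eq_self _ _)
    rw [h1', measureReal_radialRegion μ (by fun_prop) hpos, ← hd] at h1
    have h2 := integral_mono (μ := μ.toSphere)
      (f := fun u => (1 + t * h u + t ^ 2) ^ d / d)
      (g := fun u => 1 / (d : ℝ) + t * h u + (t ^ 2 + 4 ^ d * (4 * (t * C) ^ 2)))
      (integrable_toSphere_of_continuous μ (by fun_prop))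
      (integrable_toSphere_of_continuous μ (by fun_prop)) (fun u => by
        have hy : |t * h u + t ^ 2| ≤ 2 * (t * C) := by
          have := hth u
          rw [abs_le] at this ⊢
          constructor <;> nlinarith
        have h3 := one_add_pow_le_quadratic (y := t * h u + t ^ 2) (by linarith) d
        rw [← add_assoc] at h3
        have h4 : (t * h u + t ^ 2) ^ 2 ≤ (2 * (t * C)) ^ 2 := sq_le_sq' (abs_le.1 hy).1 (abs_le.1 hy).2
        have h5 := mul_le_mul_of_nonneg_left h4 (by positivity : (0 : ℝ) ≤ 4 ^ d)
        simp only
        rw [div_le_iff₀ (by linarith)]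
        have h6 : (1 / (d : ℝ)) * d = 1 := by field_simp
        have h7 : (4 : ℝ) ^ d * (4 * (t * C) ^ 2) ≤ 4 ^ d * (4 * (t * C) ^ 2) * d :=
          le_mul_of_one_le_right (by positivity) hd1
        nlinarith)
    rw [expand] at h2
    simp only [hh] at h1 h2 ⊢
    linarith

/-- The derivative at `0` of the volume of `B + t K` is the integral of the support function. -/
theorem tendsto_measureReal_closedBall_add_smul (μ : Measure E) [μ.IsAddHaarMeasure] {K : Set E}
    (hK : IsCompact K) (hne : K.Nonempty) :
    Tendsto (fun t : ℝ => (μ.real (Metric.closedBall (0 : E) 1 + t • K) -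
        μ.real (Metric.closedBall (0 : E) 1)) / t) (𝓝[>] 0)
      (𝓝 (∫ u : Metric.sphere (0 : E) 1, supportFun K u ∂μ.toSphere)) := by
  obtain ⟨C₀, hC₀⟩ := hK.isBounded.exists_norm_le
  set C := max C₀ 1
  have hC1 : 1 ≤ C := le_max_right _ _
  have hC : ∀ x ∈ K, ‖x‖ ≤ C := fun x hx => (hC₀ x hx).trans (le_max_left _ _)
  set I := ∫ u : Metric.sphere (0 : E) 1, supportFun K u ∂μ.toSphere
  have hlim : ∀ A : ℝ, Tendsto (fun t : ℝ => I + t * A) (𝓝[>] 0) (𝓝 I) := fun A => by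
    have : Tendsto (fun t : ℝ => I + t * A) (𝓝 0) (𝓝 (I + 0 * A)) :=
      (by fun_prop : Continuous fun t : ℝ => I + t * A).tendsto 0
    rw [zero_mul, add_zero] at this
    exact this.mono_left nhdsWithin_le_nhds
  have hev : ∀ᶠ t : ℝ in 𝓝[>] 0, 0 < t ∧ t * C ≤ 1 / 4 := by
    have : Set.Ioo (0 : ℝ) (1 / (4 * C)) ∈ 𝓝[>] (0 : ℝ) := Ioo_mem_nhdsGT (by positivity)
    filter_upwards [this] with t ht
    refine ⟨ht.1, ?_⟩
    have := ht.2.le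
    rw [le_div_iff₀ (by positivity)] at this
    linarith
  refine tendsto_of_tendsto_of_tendsto_of_le_of_le'
    (hlim (-(C ^ 2 * μ.toSphere.real Set.univ)))
    (hlim ((1 + 4 ^ Module.finrank ℝ E * (4 * C ^ 2)) * μ.toSphere.real Set.univ)) ?_ ?_
  · filter_upwards [hev] with t ht
    have := (measureReal_closedBall_add_smul_bounds μ hK hne hC1 hC ht.1 ht.2).1
    rw [le_div_iff₀ ht.1]
    linarith
  · filter_upwards [hev] with t ht
    have := (measureReal_closedBall_add_smul_bounds μ hK hne hC1 hC ht.1 ht.2).2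
    rw [div_le_iff₀ ht.1]
    linarith

end ParallelBody

/-! ### The constant `2κ_m` in the sphere integral of `|⟪v, u⟫|`. -/

section Normalization
open MeasureTheory

theorem integral_abs_mul_exp_neg_sq : ∫ x : ℝ, |x| * Real.exp (-x ^ 2) = 1 := by
  have h := integral_comp_abs (f := fun x : ℝ => x * Real.exp (-x ^ 2))
  simp only [sq_abs] at h
  have h2 := integral_rpow_mul_exp_neg_rpow (p := 2) (q := 1) (by norm_num) (by norm_num)
  norm_num at h2
  rw [h, h2]
  norm_num

theorem integral_abs_coord_mul_exp_neg_sq (m : ℕ) :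
    ∫ x : RSpace (m + 1), |x 0| * Real.exp (-‖x‖ ^ 2) = √Real.pi ^ m := by
  have hg : ∫ x : ℝ, Real.exp (-x ^ 2) = √Real.pi := by
    simpa using integral_gaussian 1
  rw [← (EuclideanSpace.volume_preserving_symm_measurableEquiv_toLp (Fin (m + 1))).symm.integral_comp
    (MeasurableEquiv.measurableEmbedding _)]
  have := integral_fintype_prod_volume_eq_prod (𝕜 := ℝ) (E := fun _ : Fin (m + 1) => ℝ)
    (fun i x => (if i = 0 then |x| else 1) * Real.exp (-x ^ 2))
  rw [Fin.prod_univ_succ] at this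
  simp only [if_true, Fin.succ_ne_zero, if_false, one_mul, hg, integral_abs_mul_exp_neg_sq,
    Finset.prod_const, Finset.card_univ, Fintype.card_fin] at this
  rw [← this]
  refine integral_congr_ae (Eventually.of_forall fun x => ?_)
  simp only [Finset.prod_mul_distrib, Finset.prod_ite_eq', Finset.mem_univ, if_true,
    ← Real.exp_sum, Finset.sum_neg_distrib, EuclideanSpace.norm_sq_eq]
  simp

/-- The Gaussian weight is rotation invariant, so a reflection taking the first basis vector to e
reduces this to the coordinate case, where the integral factors. -/
theorem integral_abs_inner_mul_exp_neg_sq (m : ℕ) {e : RSpace (m + 1)} (he : ‖e‖ = 1) :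
    ∫ x : RSpace (m + 1), |inner ℝ e x| * Real.exp (-‖x‖ ^ 2) = √Real.pi ^ m := by
  set e₀ : RSpace (m + 1) := EuclideanSpace.single 0 1
  have he₀ : ‖e₀‖ = ‖e‖ := by simp [e₀, he]
  set φ := (Submodule.span ℝ {e₀ - e})ᗮ.reflection
  have hφ : φ e₀ = e := Submodule.reflection_sub he₀
  rw [← integral_abs_coord_mul_exp_neg_sq, ← φ.measurePreserving.integral_comp
    φ.toHomeomorph.measurableEmbedding]
  refine integral_congr_ae (Eventually.of_forall fun x => ?_)
  simp only [← hφ, LinearIsometryEquiv.inner_map_map, LinearIsometryEquiv.norm_map]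
  simp [e₀, EuclideanSpace.inner_single_left]

theorem kappa_eq {m : ℕ} (hm : 1 ≤ m) : kappa m = √Real.pi ^ m / Real.Gamma (m / 2 + 1) := by
  have : Nonempty (Fin m) := ⟨⟨0, hm⟩⟩
  rw [kappa, vol, unitBall, EuclideanSpace.volume_closedBall]
  simp only [ENNReal.ofReal_one, one_pow, one_mul, Fintype.card_fin]
  exact ENNReal.toReal_ofReal (div_nonneg (by positivity) (Real.Gamma_pos_of_pos (by positivity)).le)

/-- The Gaussian integral of `|⟪e, x⟫|` is the sphere integral times the radial factor `Γ(m/2 + 1) /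
2`; dividing yields `2κ_m`. -/
theorem integral_sphere_abs_inner {m : ℕ} (hm : 1 ≤ m) (v : RSpace (m + 1)) :
    ∫ u : Metric.sphere (0 : RSpace (m + 1)) 1, |inner ℝ v (u : RSpace (m + 1))|
      ∂(volume : Measure (RSpace (m + 1))).toSphere = 2 * kappa m * ‖v‖ := by
  have unit : ∀ e : RSpace (m + 1), ‖e‖ = 1 →
      ∫ u : Metric.sphere (0 : RSpace (m + 1)) 1, |inner ℝ e (u : RSpace (m + 1))|
        ∂(volume : Measure (RSpace (m + 1))).toSphere = 2 * kappa m := by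
    intro e he
    have h1 := integral_homogeneous_mul_radial (volume : Measure (RSpace (m + 1)))
      (f := fun x => |inner ℝ e x|)
      (fun r x hr => by rw [real_inner_smul_right, abs_mul, abs_of_pos hr])
      (fun r => Real.exp (-r ^ 2))
    have h2 := integral_rpow_mul_exp_neg_rpow (p := 2) (q := ((m + 1 : ℕ) : ℝ)) (by norm_num)
      (by have : (0 : ℝ) ≤ ((m + 1 : ℕ) : ℝ) := Nat.cast_nonneg _
          linarith)
    simp only [Real.rpow_natCast, Real.rpow_two] at h2
    rw [integral_abs_inner_mul_exp_neg_sq m he, finrank_euclideanSpace_fin, h2] at h1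
    have h3 : (((m + 1 : ℕ) : ℝ) + 1) / 2 = m / 2 + 1 := by push_cast; ring
    have h4 : 0 < Real.Gamma ((m : ℝ) / 2 + 1) := Real.Gamma_pos_of_pos (by positivity)
    rw [h3] at h1
    rw [kappa_eq hm, h1]
    field_simp
  rcases eq_or_ne v 0 with rfl | hv
  · simp
  · have hv' : ‖v‖ ≠ 0 := norm_ne_zero_iff.2 hv
    have h1 := unit (‖v‖⁻¹ • v) (by rw [norm_smul, norm_inv, norm_norm, inv_mul_cancel₀ hv'])
    simp only [real_inner_smul_left, abs_mul, abs_inv, abs_norm] at h1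
    rw [integral_const_mul] at h1
    rw [← h1]
    field_simp

end Normalization

/-! ### `V₁` as a width integral, and its comparison with triangles and segments. -/

section FirstIntrinsicVolume
open MeasureTheory

variable {n : ℕ}

theorem firstIntrinsicVolume_eq_integral (hn : 2 ≤ n) (K : ConvexBody (RSpace n)) :
    firstIntrinsicVolume K = (1 / kappa (n - 1)) *
      ∫ u : Metric.sphere (0 : RSpace n) 1, supportFun (K : Set (RSpace n)) u
        ∂(volume : Measure (RSpace n)).toSphere := by
  have : Nonempty (Fin n) := ⟨⟨0, by omega⟩⟩
  have h := (tendsto_measureReal_closedBall_add_smul (volume : Measure (RSpace n))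
    K.isCompact K.nonempty).limUnder_eq
  have hn0 : (n : ℝ) ≠ 0 := by positivity
  rw [firstIntrinsicVolume, mixedVolumeOne]
  simp only [vol, unitBall]
  simp only [measureReal_def] at h
  rw [h]
  field_simp

theorem kappa_pos {m : ℕ} (hm : 1 ≤ m) : 0 < kappa m := by
  rw [kappa_eq hm]
  exact div_pos (by positivity) (Real.Gamma_pos_of_pos (by positivity))

/-- Antipodal invariance is transferred from the whole space: both sides, times the same positive
radial factor, are Gaussian integrals exchanged by `x ↦ -x`. -/
theorem integral_sphere_supportFun_neg (hn : 2 ≤ n) {K : Set (RSpace n)} (hK : IsCompact K)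
    (hne : K.Nonempty) :
    ∫ u : Metric.sphere (0 : RSpace n) 1, supportFun K (-(u : RSpace n))
        ∂(volume : Measure (RSpace n)).toSphere =
      ∫ u : Metric.sphere (0 : RSpace n) 1, supportFun K u
        ∂(volume : Measure (RSpace n)).toSphere := by
  have : Nonempty (Fin n) := ⟨⟨0, by omega⟩⟩
  have h1 := integral_homogeneous_mul_radial (volume : Measure (RSpace n))
    (f := supportFun K) (fun r x hr => supportFun_smul_of_pos hK hne hr x)
    (fun r => Real.exp (-r ^ 2))
  have h2 := integral_homogeneous_mul_radial (volume : Measure (RSpace n))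
    (f := fun x => supportFun K (-x))
    (fun r x hr => by rw [← smul_neg, supportFun_smul_of_pos hK hne hr])
    (fun r => Real.exp (-r ^ 2))
  have h3 := integral_neg_eq_self (fun x => supportFun K x * Real.exp (-‖x‖ ^ 2))
    (volume : Measure (RSpace n))
  simp only [norm_neg] at h3
  have h4 := integral_rpow_mul_exp_neg_rpow (p := 2) (q := ((n : ℕ) : ℝ)) (by norm_num)
    (by have : (0 : ℝ) ≤ (n : ℝ) := Nat.cast_nonneg _
        linarith)
  simp only [Real.rpow_natCast, Real.rpow_two] at h4
  rw [h2, h1, finrank_euclideanSpace_fin, h4] at h3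
  have h5 : 0 < Real.Gamma (((n : ℝ) + 1) / 2) := Real.Gamma_pos_of_pos (by positivity)
  exact mul_right_cancel₀ (by positivity) h3

/-- The first intrinsic volume as an integral of the width function. -/
theorem firstIntrinsicVolume_eq_integral_width (hn : 2 ≤ n) (K : ConvexBody (RSpace n)) :
    firstIntrinsicVolume K = (1 / (2 * kappa (n - 1))) *
      ∫ u : Metric.sphere (0 : RSpace n) 1, (supportFun (K : Set (RSpace n)) u +
        supportFun (K : Set (RSpace n)) (-(u : RSpace n)))
        ∂(volume : Measure (RSpace n)).toSphere := by
  have hc := continuous_supportFun K.isCompact K.nonempty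
  have hκ := kappa_pos (m := n - 1) (by omega)
  rw [integral_add (integrable_toSphere_of_continuous _ (by fun_prop))
    (integrable_toSphere_of_continuous _ (by fun_prop)),
    integral_sphere_supportFun_neg hn K.isCompact K.nonempty,
    firstIntrinsicVolume_eq_integral hn]
  field_simp
  ring

theorem integral_sphere_abs_inner_eq (hn : 2 ≤ n) (v : RSpace n) :
    ∫ u : Metric.sphere (0 : RSpace n) 1, |inner ℝ v (u : RSpace n)|
      ∂(volume : Measure (RSpace n)).toSphere = 2 * kappa (n - 1) * ‖v‖ := by
  obtain ⟨m, rfl⟩ : ∃ m, n = m + 1 := ⟨n - 1, by omega⟩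
  exact integral_sphere_abs_inner (by omega) v

/-- The first intrinsic volume of a convex body is at least half the perimeter of any triangle
contained in it. -/
theorem dist_add_dist_add_dist_le_firstIntrinsicVolume (hn : 2 ≤ n) (K : ConvexBody (RSpace n))
    {x y z : RSpace n} (hx : x ∈ K) (hy : y ∈ K) (hz : z ∈ K) :
    (dist x y + dist y z + dist x z) / 2 ≤ firstIntrinsicVolume K := by
  have hκ := kappa_pos (m := n - 1) (by omega)
  have hc := continuous_supportFun K.isCompact K.nonempty
  have hint : ∀ v : RSpace n, Integrable
      (fun u : Metric.sphere (0 : RSpace n) 1 => |inner ℝ v (u : RSpace n)|)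
      (volume : Measure (RSpace n)).toSphere :=
    fun v => integrable_toSphere_of_continuous _ (by fun_prop)
  have hmono := integral_mono (μ := (volume : Measure (RSpace n)).toSphere)
    (f := fun u => (|inner ℝ (x - y) (u : RSpace n)| + |inner ℝ (y - z) (u : RSpace n)| +
      |inner ℝ (x - z) (u : RSpace n)|) / 2)
    (g := fun u => supportFun (K : Set (RSpace n)) u +
        supportFun (K : Set (RSpace n)) (-(u : RSpace n)))
    (integrable_toSphere_of_continuous _ (by fun_prop))
    -- Of three numbers on a line, the largest gap is the sum of the other two, so half the sum of
    -- the gaps is the width of the triangle in direction u.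
    (integrable_toSphere_of_continuous _ (by fun_prop)) (fun u => by
      have up : ∀ {p : RSpace n}, p ∈ K → inner ℝ p (u : RSpace n) ≤
        supportFun (K : Set (RSpace n)) u := fun hp => inner_le_supportFun K.isCompact hp _
      have lo : ∀ {p : RSpace n}, p ∈ K → -inner ℝ p (u : RSpace n) ≤
        supportFun (K : Set (RSpace n)) (-(u : RSpace n)) := fun hp => by
          rw [← inner_neg_right]; exact inner_le_supportFun K.isCompact hp _
      have a1 := up hx; have a2 := up hy; have a3 := up hz
      have b1 := lo hx; have b2 := lo hy; have b3 := lo hz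
      simp only [inner_sub_left]
      rw [div_le_iff₀ two_pos]
      rcases abs_cases (inner ℝ x (u : RSpace n) - inner ℝ y (u : RSpace n)) with h | h <;>
      rcases abs_cases (inner ℝ y (u : RSpace n) - inner ℝ z (u : RSpace n)) with h' | h' <;>
      rcases abs_cases (inner ℝ x (u : RSpace n) - inner ℝ z (u : RSpace n)) with h'' | h'' <;>
      rw [h.1, h'.1, h''.1] <;> linarith)
  have hint₂ : Integrable (fun u : Metric.sphere (0 : RSpace n) 1 =>
      |inner ℝ (x - y) (u : RSpace n)| + |inner ℝ (y - z) (u : RSpace n)|)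
      (volume : Measure (RSpace n)).toSphere := (hint _).add (hint _)
  rw [integral_div, integral_add hint₂ (hint _), integral_add (hint _) (hint _),
    integral_sphere_abs_inner_eq hn, integral_sphere_abs_inner_eq hn,
    integral_sphere_abs_inner_eq hn, ← dist_eq_norm, ← dist_eq_norm, ← dist_eq_norm] at hmono
  rw [firstIntrinsicVolume_eq_integral_width hn, one_div_mul_eq_div, le_div_iff₀ (by positivity)]
  linarith

theorem firstIntrinsicVolume_segment_le (hn : 2 ≤ n) (K : ConvexBody (RSpace n))
    {x y : RSpace n} (hK : (K : Set (RSpace n)) = segment ℝ x y) :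
    firstIntrinsicVolume K ≤ dist x y := by
  have hκ := kappa_pos (m := n - 1) (by omega)
  have hc := continuous_supportFun K.isCompact K.nonempty
  have hmono := integral_mono (μ := (volume : Measure (RSpace n)).toSphere)
    (f := fun u => supportFun (K : Set (RSpace n)) u +
        supportFun (K : Set (RSpace n)) (-(u : RSpace n)))
    (g := fun u => |inner ℝ (x - y) (u : RSpace n)|)
    (integrable_toSphere_of_continuous _ (by fun_prop))
    (integrable_toSphere_of_continuous _ (by fun_prop)) (fun u => by
      obtain ⟨p, hp, h1⟩ := exists_inner_eq_supportFun K.isCompact K.nonempty (u : RSpace n)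
      obtain ⟨q, hq, h2⟩ := exists_inner_eq_supportFun K.isCompact K.nonempty (-(u : RSpace n))
      rw [hK, segment_eq_image'] at hp hq
      obtain ⟨s, hs, rfl⟩ := hp
      obtain ⟨r, hr, rfl⟩ := hq
      simp only
      rw [h1, h2, inner_neg_right, ← sub_eq_add_neg, ← inner_sub_left]
      have : x + s • (y - x) - (x + r • (y - x)) = (r - s) • (x - y) := by module
      rw [this, real_inner_smul_left]
      refine (le_abs_self _).trans ?_
      rw [abs_mul]
      refine mul_le_of_le_one_left (abs_nonneg _) ?_
      rw [abs_le]
      constructor <;> linarith [hs.1, hs.2, hr.1, hr.2])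
  rw [integral_sphere_abs_inner_eq hn, ← dist_eq_norm] at hmono
  rw [firstIntrinsicVolume_eq_integral_width hn, one_div_mul_eq_div, div_le_iff₀ (by positivity)]
  linarith

end FirstIntrinsicVolume

/-! ### Linhart's inequality, its stability and the equality case. -/

theorem exists_forall_dist_le_of_isCompact {X : Type*} [PseudoMetricSpace X] {T : Set X}
    (hT : IsCompact T) (hne : T.Nonempty) :
    ∃ a ∈ T, ∃ b ∈ T, ∀ p ∈ T, ∀ q ∈ T, dist p q ≤ dist a b := by
  obtain ⟨z, hz, hmax⟩ := (hT.prod hT).exists_isMaxOn (hne.prod hne) continuous_dist.continuousOn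
  exact ⟨z.1, hz.1, z.2, hz.2, fun p hp q hq => hmax (Set.mk_mem_prod hp hq)⟩

section Stability

variable {n : ℕ}

/-- A convex body has two points `a`, `b` on its circumsphere, of defect `s` from being antipodal,
such that the first intrinsic volume exceeds `2R` at least by a multiple of `s`. -/
theorem exists_nearly_antipodal_contact_points (hn : 2 ≤ n) (K : ConvexBody (RSpace n)) :
    ∃ a ∈ K, ∃ b ∈ K, ∃ s : ℝ, 0 ≤ s ∧
      dist a b ^ 2 + s ^ 2 = 4 * circumradius K ^ 2 ∧
      2 * circumradius K + s / 20 ≤ firstIntrinsicVolume K := by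
  obtain ⟨c, hc⟩ := exists_circumcenter K
  have contact := exists_contact_point K hc
  set R := circumradius K with hR
  have hR0 : 0 ≤ R := circumradius_nonneg K
  set T : Set (RSpace n) := (K : Set (RSpace n)) ∩ Metric.sphere c R with hT
  have hTc : IsCompact T := K.isCompact.inter_right Metric.isClosed_sphere
  have hTne : T.Nonempty := by
    obtain ⟨x, hx, hd, -⟩ := contact 0
    exact ⟨x, hx, hd⟩
  obtain ⟨a, ha, b, hb, hmax⟩ := exists_forall_dist_le_of_isCompact hTc hTne
  have hnorm : ∀ p ∈ T, ‖p - c‖ = R := fun p hp => by rw [← dist_eq_norm]; exact hp.2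
  have hdist : ∀ p q : RSpace n, dist p q ^ 2 =
      ‖p - c‖ ^ 2 - 2 * inner ℝ (p - c) (q - c) + ‖q - c‖ ^ 2 := fun p q => by
    rw [dist_eq_norm, ← norm_sub_sq_real]; congr 2; abel
  set D := dist a b with hD
  have hD0 : 0 ≤ D := dist_nonneg
  set s := ‖(a - c) + (b - c)‖ with hs
  have hs0 : 0 ≤ s := norm_nonneg _
  have hDs : D ^ 2 + s ^ 2 = 4 * R ^ 2 := by
    rw [hs, norm_add_sq_real, hD, hdist, hnorm a ha, hnorm b hb]; ring
  -- A contact point making a non-acute angle with `a - c` is at distance at least `√2 R` from a.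
  -- Hence `s ≤ √2 R`, which is needed for `hsR`.
  have hDR : 2 * R ^ 2 ≤ D ^ 2 := by
    obtain ⟨q, hq, hqd, hqi⟩ := contact (a - c)
    have hqT : q ∈ T := ⟨hq, hqd⟩
    have h1 := pow_le_pow_left₀ dist_nonneg (hmax q hqT a ha) 2
    rw [hdist, hnorm a ha, hnorm q hqT] at h1
    linarith
  obtain ⟨q, hq, hqd, hqi⟩ := contact ((a - c) + (b - c))
  have hqT : q ∈ T := ⟨hq, hqd⟩
  have hsum : 4 * R ^ 2 ≤ dist a q ^ 2 + dist b q ^ 2 := by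
    rw [dist_comm a, dist_comm b, hdist, hdist, hnorm a ha, hnorm b hb, hnorm q hqT]
    rw [inner_add_right] at hqi
    linarith
  have hα := hmax a ha q hqT
  have hβ := hmax b hb q hqT
  set α := dist a q
  set β := dist b q
  have hα0 : 0 ≤ α := dist_nonneg
  have hβ0 : 0 ≤ β := dist_nonneg
  have hαs : s ≤ α := by
    refine le_of_sq_le_sq ?_ hα0
    have := pow_le_pow_left₀ hβ0 hβ 2
    linarith
  have hβs : s ≤ β := by
    refine le_of_sq_le_sq ?_ hβ0
    have := pow_le_pow_left₀ hα0 hα 2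
    linarith
  -- As α and β lie in `[s, D]`, `(D - α)(α - s) ≥ 0` and likewise for β. Adding these to `α² + β² ≥
  -- 4R² = D² + s²` gives `(D + s)(α + β) ≥ (D + s)²`.
  have hαβ : D + s ≤ α + β := by
    have h1 := mul_nonneg (sub_nonneg.2 hα) (sub_nonneg.2 hαs)
    have h2 := mul_nonneg (sub_nonneg.2 hβ) (sub_nonneg.2 hβs)
    by_contra! h
    have h3 : 0 < D + s := by linarith
    nlinarith
  have hV := dist_add_dist_add_dist_le_firstIntrinsicVolume hn K ha.1 hb.1 hq
  refine ⟨a, ha.1, b, hb.1, s, hs0, hDs, ?_⟩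
  have hsR : s ≤ 29 / 20 * R := le_of_sq_le_sq (by nlinarith) (by linarith)
  -- The half-perimeter is at least `D + s/2`, so the loss must have a coefficient below 1/2; `9/20`
  -- leaves the gain `s/20`. It is admissible because `s ≤ 29/20 * R`, where `29/20` is a rational
  -- bound above `√2`.
  have hlow : 2 * R - 9 / 20 * s ≤ D := by
    refine le_of_sq_le_sq ?_ hD0
    have : D ^ 2 = 4 * R ^ 2 - s ^ 2 := by linarith
    rw [this]
    nlinarith [mul_nonneg hs0 (sub_nonneg.2 hsR)]
  change 2 * R + s / 20 ≤ _
  linarith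

theorem two_mul_circumradius_le_firstIntrinsicVolume (hn : 2 ≤ n) (K : ConvexBody (RSpace n)) :
    2 * circumradius K ≤ firstIntrinsicVolume K := by
  obtain ⟨a, -, b, -, s, hs, -, h⟩ := exists_nearly_antipodal_contact_points hn K
  linarith

theorem dist_le_two_mul_circumradius (K : ConvexBody (RSpace n)) {x y : RSpace n}
    (hx : x ∈ K) (hy : y ∈ K) : dist x y ≤ 2 * circumradius K := by
  obtain ⟨c, hc⟩ := exists_circumcenter K
  have h1 : dist x c ≤ circumradius K := hc hx
  have h2 : dist y c ≤ circumradius K := hc hy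
  linarith [dist_triangle_right x y c]

theorem circumradius_pos (K : ConvexBody (RSpace n)) (hK : (K : Set (RSpace n)).Nontrivial) :
    0 < circumradius K := by
  obtain ⟨x, hx, y, hy, hxy⟩ := hK
  have := dist_le_two_mul_circumradius K hx hy
  linarith [dist_pos.2 hxy]

/-- Quantitative thinness: if `[x, y]` is a diameter of a set containing `z` and the detour through
`z` is short, then `z` is close to a point of the segment, in orthogonal direction. -/
theorem exists_segment_add_orthogonal {E : Type*} [NormedAddCommGroup E] [InnerProductSpace ℝ E]
    {x y z : E} (hxy : x ≠ y) (hxz : dist x z ≤ dist x y) (hyz : dist y z ≤ dist x y) {δ : ℝ}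
    (hδ : dist x z + dist y z ≤ dist x y + δ) :
    ∃ p ∈ segment ℝ x y, ∃ w : E, z = p + w ∧ inner ℝ w (y - x) = 0 ∧
      ‖w‖ ^ 2 ≤ dist x y * δ := by
  set D := dist x y with hD
  have hD0 : 0 < D := dist_pos.2 hxy
  have hDn : ‖y - x‖ = D := by rw [hD, dist_comm, dist_eq_norm]
  set τ := inner ℝ (z - x) (y - x) / D ^ 2 with hτ
  have hτD : τ * D ^ 2 = inner ℝ (z - x) (y - x) := by rw [hτ]; field_simp
  set w := z - (x + τ • (y - x)) with hw
  have hworth : inner ℝ w (y - x) = 0 := by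
    have : w = (z - x) - τ • (y - x) := by rw [hw]; abel
    rw [this, inner_sub_left, real_inner_smul_left, real_inner_self_eq_norm_sq, hDn, ← hτD]
    ring
  have hx2 : dist x z ^ 2 = (τ * D) ^ 2 + ‖w‖ ^ 2 := by
    have : z - x = τ • (y - x) + w := by rw [hw]; abel
    rw [dist_comm, dist_eq_norm, this, norm_add_sq_real, norm_smul, hDn, real_inner_smul_left,
      real_inner_comm, hworth, Real.norm_eq_abs, mul_pow, sq_abs]
    ring
  have hy2 : dist y z ^ 2 = ((1 - τ) * D) ^ 2 + ‖w‖ ^ 2 := by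
    have : z - y = (τ - 1) • (y - x) + w := by rw [hw]; module
    rw [dist_comm, dist_eq_norm, this, norm_add_sq_real, norm_smul, hDn, real_inner_smul_left,
      real_inner_comm, hworth, Real.norm_eq_abs, mul_pow, sq_abs]
    ring
  set α := dist x z
  set β := dist y z
  have hα0 : 0 ≤ α := dist_nonneg
  have hβ0 : 0 ≤ β := dist_nonneg
  have hα2 := pow_le_pow_left₀ hα0 hxz 2
  have hβ2 := pow_le_pow_left₀ hβ0 hyz 2
  have hw0 := sq_nonneg ‖w‖
  have hDsq : 0 < D ^ 2 := by positivity
  -- A foot outside the segment would put z farther from one endpoint than `D`.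
  have hτ1 : τ ≤ 1 := by
    by_contra! h
    nlinarith
  have hτ0 : 0 ≤ τ := by
    by_contra! h
    nlinarith
  have ha : 0 ≤ τ * D := by positivity
  have hb : 0 ≤ (1 - τ) * D := mul_nonneg (by linarith) hD0.le
  have hαa : τ * D ≤ α := le_of_sq_le_sq (by linarith) hα0
  have hβb : (1 - τ) * D ≤ β := le_of_sq_le_sq (by linarith) hβ0
  have h1 : ‖w‖ ^ 2 ≤ (α - τ * D) * (2 * D) := by
    have : ‖w‖ ^ 2 = (α - τ * D) * (α + τ * D) := by linear_combination -hx2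
    rw [this]
    exact mul_le_mul_of_nonneg_left (by linarith) (by linarith)
  have h2 : ‖w‖ ^ 2 ≤ (β - (1 - τ) * D) * (2 * D) := by
    have : ‖w‖ ^ 2 = (β - (1 - τ) * D) * (β + (1 - τ) * D) := by linear_combination -hy2
    rw [this]
    exact mul_le_mul_of_nonneg_left (by linarith) (by linarith)
  refine ⟨x + τ • (y - x), ?_, w, by rw [hw]; abel, hworth, ?_⟩
  · rw [segment_eq_image']
    exact ⟨τ, ⟨hτ0, hτ1⟩, rfl⟩
  -- Adding `h1` and `h2` gives `2‖w‖² ≤ 2D(α + β - D) ≤ 2Dδ`.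
  · nlinarith

/-- Stability of the inequality `2R ≤ V₁`: a convex body with nearly minimal first intrinsic volume
is close to a diameter of it. -/
theorem exists_segment_of_firstIntrinsicVolume_le (hn : 2 ≤ n) (K : ConvexBody (RSpace n))
    (hK : (K : Set (RSpace n)).Nontrivial) {ε : ℝ} (hε : 0 ≤ ε) (hε' : ε ≤ 1 / 20)
    (hV : firstIntrinsicVolume K ≤ (2 + ε) * circumradius K) :
    ∃ x y : RSpace n, x ≠ y ∧ (2 - 200 * ε ^ 2) * circumradius K ≤ dist x y ∧
      segment ℝ x y ⊆ (K : Set (RSpace n)) ∧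
      (K : Set (RSpace n)) ⊆
        segment ℝ x y + (7 * circumradius K * Real.sqrt ε) • orthBall x y := by
  have hRpos := circumradius_pos K hK
  obtain ⟨x, hx, y, hy, hmax⟩ := exists_forall_dist_le_of_isCompact K.isCompact K.nonempty
  have hdiam : (2 - 200 * ε ^ 2) * circumradius K ≤ dist x y := by
    obtain ⟨a, ha, b, hb, s, hs, hDs, h⟩ := exists_nearly_antipodal_contact_points hn K
    refine le_trans ?_ (hmax a ha b hb)
    have hsε : s ≤ 20 * ε * circumradius K := by linarith
    have hs2 := pow_le_pow_left₀ hs hsε 2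
    -- With `s ≤ 20εR` it suffices that `(2 - 200ε²)² ≤ 4 - 400ε²`, which holds for `ε² ≤ 1/100`.
    refine le_of_sq_le_sq ?_ dist_nonneg
    have : dist a b ^ 2 = 4 * circumradius K ^ 2 - s ^ 2 := by linarith
    rw [this]
    have h1 : ε ^ 2 ≤ 1 / 400 := by nlinarith
    have h2 : 0 ≤ ε ^ 2 * circumradius K ^ 2 := by positivity
    nlinarith
  have hε2 : ε ^ 2 ≤ ε / 20 := by nlinarith
  have hDpos : 0 < dist x y := lt_of_lt_of_le (mul_pos (by nlinarith) hRpos) hdiam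
  have hxy : x ≠ y := dist_pos.1 hDpos
  refine ⟨x, y, hxy, hdiam, K.convex.segment_subset hx hy, fun z hz => ?_⟩
  have hV3 := dist_add_dist_add_dist_le_firstIntrinsicVolume hn K hx hy hz
  -- The detour exceeds `dist x y` by at most `(4 + 2ε)R - 2 dist x y`, and `dist x y ≥ (2 - 10ε)R`
  -- by `hε2`; hence 22. Then `‖w‖² ≤ 2R · 22εR = 44εR² ≤ (7R√ε)²`.
  obtain ⟨p, hp, w, rfl, horth, hw⟩ := exists_segment_add_orthogonal hxy (hmax x hx z hz)
    (hmax y hy z hz) (δ := 22 * ε * circumradius K) (by nlinarith)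
  refine Set.add_mem_add hp ?_
  set ρ := 7 * circumradius K * Real.sqrt ε with hρ
  have hρ0 : 0 ≤ ρ := by positivity
  have hwρ : ‖w‖ ≤ ρ := by
    refine le_of_sq_le_sq (hw.trans ?_) hρ0
    rw [hρ, mul_pow, Real.sq_sqrt hε]
    have := mul_le_mul_of_nonneg_right (dist_le_two_mul_circumradius K hx hy)
      (by positivity : 0 ≤ 22 * ε * circumradius K)
    nlinarith [mul_nonneg hε (sq_nonneg (circumradius K))]
  rcases hρ0.eq_or_lt with h0 | h0
  · have : w = 0 := norm_le_zero_iff.1 (by rw [h0]; exact hwρ)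
    exact ⟨0, by simp [orthBall], by simp [this]⟩
  · refine ⟨ρ⁻¹ • w, ⟨?_, ?_⟩, by simp [smul_smul, h0.ne']⟩
    · rw [norm_smul, norm_inv, Real.norm_eq_abs, abs_of_pos h0, inv_mul_le_iff₀ h0]
      linarith
    · rw [real_inner_smul_left, horth, mul_zero]

theorem firstIntrinsicVolume_eq_two_mul_circumradius_iff (hn : 2 ≤ n)
    (K : ConvexBody (RSpace n)) :
    firstIntrinsicVolume K = 2 * circumradius K ↔
      ∃ x y : RSpace n, (K : Set (RSpace n)) = segment ℝ x y := by
  constructor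
  · intro h
    rcases Set.subsingleton_or_nontrivial (K : Set (RSpace n)) with hs | hK
    · obtain ⟨x, hx⟩ := K.nonempty
      exact ⟨x, x, by rw [segment_same]; exact hs.eq_singleton_of_mem hx⟩
    -- At `ε = 0` the orthogonal summand shrinks to the origin, so K is squeezed onto the segment.
    · obtain ⟨x, y, -, -, h1, h2⟩ := exists_segment_of_firstIntrinsicVolume_le hn K hK le_rfl
        (by norm_num) (by rw [h, add_zero])
      refine ⟨x, y, (h2.trans ?_).antisymm h1⟩
      rw [Real.sqrt_zero, mul_zero]
      exact (Set.add_subset_add_left (Set.zero_smul_set_subset _)).trans (by simp)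
  · rintro ⟨x, y, h⟩
    have hx : x ∈ (K : Set (RSpace n)) := h ▸ left_mem_segment ℝ x y
    have hy : y ∈ (K : Set (RSpace n)) := h ▸ right_mem_segment ℝ x y
    exact ((firstIntrinsicVolume_segment_le hn K h).trans
      (dist_le_two_mul_circumradius K hx hy)).antisymm
      (two_mul_circumradius_le_firstIntrinsicVolume hn K)

end Stability

theorem theorem1p4 (n : ℕ) (hn : 2 ≤ n) :
    (∀ K : ConvexBody (RSpace n),
      2 * circumradius K ≤ firstIntrinsicVolume K ∧
      (firstIntrinsicVolume K = 2 * circumradius K ↔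
        ∃ x y : RSpace n, (K : Set (RSpace n)) = segment ℝ x y)) ∧
    (∃ ε₀ γ₁ γ₂ : ℝ, 0 < ε₀ ∧ 0 < γ₁ ∧ 0 < γ₂ ∧
      ∀ K : ConvexBody (RSpace n), (K : Set (RSpace n)).Nontrivial →
      ∀ ε : ℝ, 0 ≤ ε → ε ≤ ε₀ →
      firstIntrinsicVolume K ≤ (2 + ε) * circumradius K →
      ∃ x y : RSpace n, x ≠ y ∧
        (2 - γ₁ * ε ^ 2) * circumradius K ≤ dist x y ∧
        segment ℝ x y ⊆ (K : Set (RSpace n)) ∧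
        (K : Set (RSpace n)) ⊆
          segment ℝ x y + (γ₂ * circumradius K * Real.sqrt ε) • orthBall x y) := by
  refine ⟨fun K => ⟨two_mul_circumradius_le_firstIntrinsicVolume hn K,
    firstIntrinsicVolume_eq_two_mul_circumradius_iff hn K⟩,
    1 / 20, 200, 7, by norm_num, by norm_num, by norm_num, fun K hK ε hε hε' hV => ?_⟩
  exact exists_segment_of_firstIntrinsicVolume_le hn K hK hε hε' hV
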